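/- **Theorem (Trotter–Kato type).** Let $X$ be a Banach space over $\mathbb{K}\in\{\mathbb{R},\mathbb{C}\}$, let $Y$ be an ordered Banach space over $\mathbb{K}$ with closed positive cone, and let $S: D(S)\subseteq X\to Y$ be a closed linear operator. For a linear operator $(A,D(A))$ in $X$ put $$C:=\overline{\{x\in D(S): Sx\ge 0\}},\qquad C_A:=\overline{\{x\in D(A)\cap D(S): Sx\ge 0\}}.$$ A strongly continuous semigroup $(e^{tA})_{t\ge 0}$ on $X$ with generator $(A,D(A))$ is called *$S$-shape preserving* if $C=C_A$ and $e^{tA}C\subseteq C$ for all $t\ge 0$. Let $(A,D(A))$ and $(A_n,D(A_n))$, $n\in\mathbb{N}$, be generators of strongly continuous semigroups $(e^{tA})_{t\ge0}$ and $(e^{tA_n})_{t\ge0}$ on $X$, and suppose that each $(e^{tA_n})_{t\ge 0}$ is $S$-shape preserving. Assume that there are constants $M\ge 1$ and $\omega\in\mathbb{R}$ such that $$\|e^{tA}\|\le Me^{\omega t}\quad\text{and}\quad \|e^{tA_n}\|\le Me^{\omega t}\qquad\text{for all } t\ge 0,\ n\in\mathbb{N},$$ and that for some $\lambda\in\mathbb{K}$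 with $\operatorname{Re}\lambda>\omega$ $$\lim_{n\to\infty}(\lambda-A_n)^{-1}x=(\lambda-A)^{-1}x\qquad\text{for all } x\in X.$$ If $C_A=C$, then $(e^{tA})_{t\ge 0}$ is $S$-shape preserving. -/

import Mathlib

open Filter
open scoped NNReal Topology

namespace ShapePreserving

section Semigroups

variable {𝕜 X : Type*} [RCLike 𝕜] [NormedAddCommGroup X] [NormedSpace 𝕜 X]

/-- A strongly continuous semigroup (`C₀`-semigroup) of bounded linear operators on `X`. -/
structure IsC0Semigroup (T : ℝ≥0 → X →L[𝕜] X) : Prop where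
  map_zero : T 0 = ContinuousLinearMap.id 𝕜 X
  map_add : ∀ s t : ℝ≥0, T (s + t) = (T s).comp (T t)
  continuous_orbit : ∀ x : X, Continuous fun t : ℝ≥0 => T t x

/-- `(A, D(A))` is the generator of `T`: one has `x ∈ D(A)` and `A x = y` if and only if
`(T h x - x) / h → y` as `h ↓ 0`. -/
def IsGenerator (A : X →ₗ.[𝕜] X) (T : ℝ≥0 → X →L[𝕜] X) : Prop :=
  ∀ x y : X, (x, y) ∈ A.graph ↔
    Tendsto (fun h : ℝ≥0 => (((h : ℝ) : 𝕜))⁻¹ • (T h x - x)) (𝓝[>] 0) (𝓝 y)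

/-- The map `(z - A)⁻¹ : X → D(A) ⊆ X`, the inverse of the map `x ↦ z x - A x` from `D(A)` to `X`.
It is the genuine inverse whenever the latter map is bijective, in particular whenever `A` generates
a `C₀`-semigroup with `‖T t‖ ≤ M e^{ω t}` and `Re z > ω`. -/
noncomputable def resolvent (A : X →ₗ.[𝕜] X) (z : 𝕜) (y : X) : X :=
  (Function.invFun (fun x : A.domain => z • (x : X) - A x) y : A.domain)

end Semigroups

section Shape

variable {𝕜 X Y : Type*} [RCLike 𝕜] [NormedAddCommGroup X] [NormedSpace 𝕜 X]
  [NormedAddCommGroup Y] [NormedSpace 𝕜 Y] [PartialOrder Y]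

/-- `C`, the closure of `{x ∈ D(S) : S x ≥ 0}`. -/
def shapeCone (S : X →ₗ.[𝕜] Y) : Set X :=
  closure {x : X | ∃ hx : x ∈ S.domain, 0 ≤ S ⟨x, hx⟩}

/-- `C_A`, the closure of `{x ∈ D(A) ∩ D(S) : S x ≥ 0}`. -/
def shapeConeOf (S : X →ₗ.[𝕜] Y) (A : X →ₗ.[𝕜] X) : Set X :=
  closure {x : X | x ∈ A.domain ∧ ∃ hx : x ∈ S.domain, 0 ≤ S ⟨x, hx⟩}

/-- The semigroup `T` with generator `A` preserves `S`-shape: `C = C_A`, and every `T t`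
maps `C` into itself. -/
def PreservesShape (S : X →ₗ.[𝕜] Y) (A : X →ₗ.[𝕜] X) (T : ℝ≥0 → X →L[𝕜] X) : Prop :=
  shapeCone S = shapeConeOf S A ∧ ∀ t : ℝ≥0, Set.MapsTo (T t) (shapeCone S) (shapeCone S)

end Shape

end ShapePreserving

/-! The cone `shapeCone S` is closed, so a pointwise limit of the operators `Tn n t` maps it into
itself; with `C_A = C` given, only the Trotter–Kato convergence `Tn n t x → T t x` is left.

For that, pass to `e^{-zt} T t`, which decays exponentially because `Re z > ω`; the resolvents
become the operators `R`, `Rn`, minus the inverses of the generators, bounded uniformly in `n`.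
Integrating the derivative of `s ↦ Sn (t - s) Rn (S s) R x` expresses `Rn (S t - Sn t) R x` through
`R - Rn` (`integral_apply_sub_apply`), and dominated convergence sends it to `0`. Commuting
resolvents with semigroups turns this into convergence on the range of `R²`, which is dense; the
uniform bound on the semigroups extends it to all of `X`. -/

namespace ShapePreserving

open MeasureTheory Set

/-! ### Orbits of real semigroups and their right derivatives -/

section Real

variable {X : Type*} [NormedAddCommGroup X] [NormedSpace ℝ X]

/-- `x` lies in the domain of the generator of `S`, which maps it to `y`. -/
def HasGen (S : ℝ≥0 → X →L[ℝ] X) (x y : X) : Prop :=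
  Tendsto (fun h : ℝ≥0 => (h : ℝ)⁻¹ • (S h x - x)) (𝓝[>] 0) (𝓝 y)

variable {S : ℝ≥0 → X →L[ℝ] X} {x y x' y' : X} {M ε : ℝ}

theorem HasGen.add (h : HasGen S x y) (h' : HasGen S x' y') : HasGen S (x + x') (y + y') := by
  refine (Tendsto.add h h').congr fun t => ?_
  rw [← smul_add, map_add]
  congr 1
  abel

theorem HasGen.smul (h : HasGen S x y) (c : ℝ) : HasGen S (c • x) (c • y) := by
  refine (Tendsto.const_smul h c).congr fun t => ?_
  rw [smul_comm, map_smul, smul_sub]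

theorem HasGen.apply (hS : IsC0Semigroup S) (h : HasGen S x y) (t : ℝ≥0) :
    HasGen S (S t x) (S t y) := by
  refine (((S t).continuous.tendsto y).comp h).congr fun r => ?_
  have : S r (S t x) = S t (S r x) := by
    rw [← ContinuousLinearMap.comp_apply, ← ContinuousLinearMap.comp_apply, ← hS.map_add,
      ← hS.map_add, add_comm]
  simp [this]

theorem IsC0Semigroup.map_add_apply (hS : IsC0Semigroup S) (s t : ℝ≥0) (x : X) :
    S (s + t) x = S s (S t x) := by
  rw [hS.map_add]; rfl

theorem IsC0Semigroup.map_zero_apply (hS : IsC0Semigroup S) (x : X) : S 0 x = x := by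
  rw [hS.map_zero]; rfl

/-- A bounded semigroup is jointly continuous. -/
theorem IsC0Semigroup.tendsto_apply (hS : IsC0Semigroup S) (hb : ∀ t, ‖S t‖ ≤ M)
    {ι : Type*} {l : Filter ι} {f : ι → ℝ≥0} {g : ι → X} {t : ℝ≥0} {w : X}
    (hf : Tendsto f l (𝓝 t)) (hg : Tendsto g l (𝓝 w)) :
    Tendsto (fun i => S (f i) (g i)) l (𝓝 (S t w)) := by
  have h1 : Tendsto (fun i => S (f i) w) l (𝓝 (S t w)) :=
    ((hS.continuous_orbit w).tendsto t).comp hf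
  have h2 : Tendsto (fun i => S (f i) (g i - w)) l (𝓝 0) := by
    refine squeeze_zero_norm (fun i => (S (f i)).le_of_opNorm_le (hb _) _) ?_
    simpa using (((tendsto_sub_nhds_zero_iff).2 hg).norm).const_mul M
  simpa using h2.add h1

theorem tendsto_sub_toNNReal (s : ℝ) :
    Tendsto (fun r : ℝ => (r - s).toNNReal) (𝓝[>] s) (𝓝[>] 0) := by
  refine tendsto_nhdsWithin_iff.2 ⟨?_, ?_⟩
  · have : Continuous fun r : ℝ => (r - s).toNNReal := by fun_prop
    simpa using (this.tendsto s).mono_left nhdsWithin_le_nhds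
  · filter_upwards [self_mem_nhdsWithin] with r hr
    simpa using hr

/-- A right derivative is obtained from increments by nonnegative reals. -/
theorem hasDerivWithinAt_Ioi_of_tendsto {u : ℝ → X} {s : ℝ} {v : X}
    (h : Tendsto (fun h : ℝ≥0 => (h : ℝ)⁻¹ • (u (s + h) - u s)) (𝓝[>] 0) (𝓝 v)) :
    HasDerivWithinAt u v (Ioi s) s := by
  rw [hasDerivWithinAt_iff_tendsto_slope' (by simp)]
  refine (h.comp (tendsto_sub_toNNReal s)).congr' ?_
  filter_upwards [self_mem_nhdsWithin] with r hr
  have : 0 ≤ r - s := sub_nonneg.2 (le_of_lt hr)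
  simp [slope_def_module, Real.coe_toNNReal _ this]

theorem tendsto_of_hasDerivAt {u : ℝ → X} {s : ℝ} {v : X} (h : HasDerivAt u v s) :
    Tendsto (fun h : ℝ≥0 => (h : ℝ)⁻¹ • (u (s + h) - u s)) (𝓝[>] 0) (𝓝 v) := by
  have h1 := hasDerivAt_iff_tendsto_slope_zero.1 h
  refine h1.comp (tendsto_nhdsWithin_iff.2 ⟨?_, ?_⟩)
  · exact (NNReal.continuous_coe.tendsto' 0 0 rfl).mono_left nhdsWithin_le_nhds
  · filter_upwards [self_mem_nhdsWithin] with r hr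
    have : (0 : ℝ≥0) < r := hr
    simpa using this.ne'

/-- Truncation by `toNNReal` makes the orbit constant on `r ≤ 0`. The extension is continuous on all
of `ℝ`, so its primitive is differentiable from both sides even at `0`. -/
theorem IsC0Semigroup.continuous_real (hS : IsC0Semigroup S) (x : X) :
    Continuous fun r : ℝ => S r.toNNReal x :=
  (hS.continuous_orbit x).comp continuous_real_toNNReal

theorem toNNReal_add_coe {s : ℝ} (hs : 0 ≤ s) (h : ℝ≥0) :
    (s + h).toNNReal = s.toNNReal + h := by
  rw [Real.toNNReal_add hs h.coe_nonneg, Real.toNNReal_coe]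

theorem HasGen.hasDerivWithinAt (hS : IsC0Semigroup S) (h : HasGen S x y) {s : ℝ} (hs : 0 ≤ s) :
    HasDerivWithinAt (fun r : ℝ => S r.toNNReal x) (S s.toNNReal y) (Ioi s) s := by
  refine hasDerivWithinAt_Ioi_of_tendsto ((h.apply hS s.toNNReal).congr fun r => ?_)
  rw [toNNReal_add_coe hs, add_comm, hS.map_add_apply]

theorem norm_le_of_exp (hM : 1 ≤ M) (hε : 0 < ε) (hb : ∀ t, ‖S t‖ ≤ M * Real.exp (-ε * t))
    (t : ℝ≥0) : ‖S t‖ ≤ M := by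
  refine (hb t).trans (mul_le_of_le_one_right (by linarith) (Real.exp_le_one_iff.2 ?_))
  have := mul_nonneg hε.le t.coe_nonneg
  simpa using this

theorem apply_comm_of_hasGen (hS : IsC0Semigroup S) {R : X →L[ℝ] X}
    (hR : ∀ x y, HasGen S x (-y) ↔ R y = x) (t : ℝ≥0) (y : X) : R (S t y) = S t (R y) := by
  rw [← hR, ← map_neg]
  exact ((hR _ _).2 rfl).apply hS t

/-! ### Integrals along orbits and inversion of the generator -/

variable [CompleteSpace X]

/-- `HasGen` yields only a right derivative of the orbit; since the orbit is continuous and this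
derivative integrable, the fundamental theorem of calculus still applies. -/
theorem HasGen.integral_eq (hS : IsC0Semigroup S) (h : HasGen S x y) (t : ℝ≥0) :
    ∫ s in (0 : ℝ)..t, S s.toNNReal y = S t x - x := by
  rw [intervalIntegral.integral_eq_sub_of_hasDeriv_right_of_le t.coe_nonneg
    (hS.continuous_real x).continuousOn (fun s hs => h.hasDerivWithinAt hS hs.1.le)
    ((hS.continuous_real y).intervalIntegrable _ _)]
  simp [hS.map_zero_apply]

/-- `S h` shifts the interval of integration to `[h, t + h]`, so the increment is that of the
primitive at `t` minus that at `0`. -/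
theorem IsC0Semigroup.hasGen_integral (hS : IsC0Semigroup S) (y : X) (t : ℝ≥0) :
    HasGen S (∫ s in (0 : ℝ)..t, S s.toNNReal y) (S t y - y) := by
  have hc := hS.continuous_real y
  have hd : ∀ r : ℝ, HasDerivAt (fun r : ℝ => ∫ s in (0 : ℝ)..r, S s.toNNReal y)
      (S r.toNNReal y) r := fun r => (hc.integral_hasStrictDerivAt 0 r).hasDerivAt
  have h1 := (tendsto_of_hasDerivAt (hd t)).sub (tendsto_of_hasDerivAt (hd 0))
  simp only [Real.toNNReal_coe, Real.toNNReal_zero, hS.map_zero_apply] at h1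
  refine h1.congr fun h => ?_
  have h2 : S h (∫ s in (0 : ℝ)..t, S s.toNNReal y) =
      (∫ s in (0 : ℝ)..(t + h), S s.toNNReal y) - ∫ s in (0 : ℝ)..h, S s.toNNReal y := by
    rw [intervalIntegral.integral_interval_sub_left (hc.intervalIntegrable _ _)
      (hc.intervalIntegrable _ _), ← (S h).intervalIntegral_comp_comm (hc.intervalIntegrable _ _)]
    have := intervalIntegral.integral_comp_add_right (a := 0) (b := t)
      (fun s : ℝ => S s.toNNReal y) (h : ℝ)
    rw [zero_add] at this
    rw [← this]
    refine intervalIntegral.integral_congr fun s hs => ?_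
    rw [uIcc_of_le t.coe_nonneg] at hs
    rw [toNNReal_add_coe hs.1, add_comm, hS.map_add_apply]
  rw [h2, ← smul_sub]
  simp only [zero_add, intervalIntegral.integral_same, sub_zero]
  congr 1
  abel

theorem IsC0Semigroup.dense_domain (hS : IsC0Semigroup S) : Dense {x : X | ∃ y, HasGen S x y} := by
  intro y
  have h1 := tendsto_of_hasDerivAt ((hS.continuous_real y).integral_hasStrictDerivAt 0 0).hasDerivAt
  simp only [Real.toNNReal_zero, hS.map_zero_apply, zero_add, intervalIntegral.integral_same,
    sub_zero] at h1
  -- The averages of the orbit over `[0, h]` lie in the domain and tend to `y`.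
  exact mem_closure_of_tendsto h1
    (Eventually.of_forall fun h => ⟨_, (hS.hasGen_integral y h).smul _⟩)

theorem exists_exp_le_half (M : ℝ) (hε : 0 < ε) : ∃ t : ℝ≥0, M * Real.exp (-ε * t) ≤ 1 / 2 := by
  have h1 : Tendsto (fun t : ℝ≥0 => M * Real.exp (-ε * t)) atTop (𝓝 (M * 0)) := by
    refine (Real.tendsto_exp_atBot.comp ?_).const_mul M
    exact (NNReal.tendsto_coe_atTop.2 tendsto_id).const_mul_atTop_of_neg (neg_lt_zero.2 hε)
  rw [mul_zero] at h1
  exact ((h1.eventually (gt_mem_nhds (by norm_num : (0 : ℝ) < 1 / 2))).exists).imp fun _ h => h.le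

/-- The inverse of the generator of an exponentially stable semigroup is bounded, with a bound that
depends on the constants of stability only. -/
theorem exists_norm_le_of_hasGen (X : Type*) [NormedAddCommGroup X] [NormedSpace ℝ X]
    [CompleteSpace X] (hM : 1 ≤ M) (hε : 0 < ε) :
    ∃ K : ℝ, 0 ≤ K ∧ ∀ S : ℝ≥0 → X →L[ℝ] X, IsC0Semigroup S →
      (∀ t, ‖S t‖ ≤ M * Real.exp (-ε * t)) → ∀ x y, HasGen S x y → ‖x‖ ≤ K * ‖y‖ := by
  obtain ⟨t, ht⟩ := exists_exp_le_half M hε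
  -- From `‖x‖ ≤ ‖S t x‖ + ‖S t x - x‖ ≤ ‖x‖ / 2 + M t ‖y‖`, the first term being absorbed on the
  -- left.
  refine ⟨2 * (M * t), by positivity, fun S hS hb x y h => ?_⟩
  have h1 : ‖∫ s in (0 : ℝ)..t, S s.toNNReal y‖ ≤ M * ‖y‖ * |(t : ℝ) - 0| :=
    intervalIntegral.norm_integral_le_of_norm_le_const fun s _ =>
      (S _).le_of_opNorm_le (norm_le_of_exp hM hε hb _) y
  rw [h.integral_eq hS, sub_zero, abs_of_nonneg t.coe_nonneg] at h1
  have h2 : ‖S t x‖ ≤ 1 / 2 * ‖x‖ := (S t).le_of_opNorm_le ((hb t).trans ht) x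
  have h3 : ‖x‖ ≤ ‖S t x‖ + ‖S t x - x‖ := by
    simpa using norm_sub_le (S t x) (S t x - x)
  nlinarith

/-- The generator of an exponentially stable semigroup is onto. -/
theorem IsC0Semigroup.exists_hasGen (hS : IsC0Semigroup S) (hε : 0 < ε)
    (hb : ∀ t, ‖S t‖ ≤ M * Real.exp (-ε * t)) (y : X) : ∃ x, HasGen S x y := by
  obtain ⟨t, ht⟩ := exists_exp_le_half M hε
  -- As `‖S t‖ < 1`, the operator `1 - S t` is invertible. For `w = -(1 - S t)⁻¹ y` the generator
  -- maps the integral of the orbit of `w` over `[0, t]` to `S t w - w = y`.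
  let u := Units.oneSub (S t) (((hb t).trans ht).trans_lt (by norm_num))
  refine ⟨∫ s in (0 : ℝ)..t, S s.toNNReal (-(↑u⁻¹ : X →L[ℝ] X) y), ?_⟩
  convert hS.hasGen_integral (-(↑u⁻¹ : X →L[ℝ] X) y) t using 1
  have h1 : (↑u * ↑u⁻¹ : X →L[ℝ] X) y = y := by rw [Units.mul_inv]; rfl
  have h2 : (↑u * ↑u⁻¹ : X →L[ℝ] X) y =
      (↑u⁻¹ : X →L[ℝ] X) y - S t ((↑u⁻¹ : X →L[ℝ] X) y) := rfl
  rw [map_neg, sub_neg_eq_add, neg_add_eq_sub, ← h2, h1]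

/-- The bound `hK`, applied to a difference of two preimages, gives uniqueness and hence linearity
of the choice; it also gives continuity. The sign makes `R` the resolvent at `0`. -/
theorem IsC0Semigroup.exists_inverse (hS : IsC0Semigroup S) (hε : 0 < ε)
    (hb : ∀ t, ‖S t‖ ≤ M * Real.exp (-ε * t)) {K : ℝ}
    (hK : ∀ x y, HasGen S x y → ‖x‖ ≤ K * ‖y‖) :
    ∃ R : X →L[ℝ] X, ∀ x y, HasGen S x (-y) ↔ R y = x := by
  choose f hf using fun y => hS.exists_hasGen hε hb (-y)
  have huniq : ∀ x y, HasGen S x (-y) → f y = x := fun x y h => by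
    have h1 := hK _ _ ((hf y).add (h.smul (-1)))
    rw [neg_one_smul, neg_one_smul, neg_neg, neg_add_cancel, norm_zero, mul_zero] at h1
    exact eq_of_sub_eq_zero (norm_le_zero_iff.1 (by rwa [sub_eq_add_neg]))
  let L : X →ₗ[ℝ] X :=
    { toFun := f
      map_add' := fun y z => huniq _ _ (by rw [neg_add]; exact (hf y).add (hf z))
      map_smul' := fun c y => huniq _ _ (by rw [← smul_neg]; exact (hf y).smul c) }
  refine ⟨L.mkContinuous K fun y => (hK _ _ (hf y)).trans_eq (by rw [norm_neg]), fun x y => ⟨huniq x y, ?_⟩⟩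
  rintro rfl
  exact hf y

/-- The variation of constants formula for the difference of two semigroups. -/
theorem integral_apply_sub_apply {S' : ℝ≥0 → X →L[ℝ] X} (hS : IsC0Semigroup S)
    (hS' : IsC0Semigroup S') (hb' : ∀ t, ‖S' t‖ ≤ M)
    {R R' : X →L[ℝ] X} (hR : ∀ x y, HasGen S x (-y) ↔ R y = x)
    (hR' : ∀ x y, HasGen S' x (-y) ↔ R' y = x) (t : ℝ≥0) (x : X) :
    ∫ s in (0 : ℝ)..t, S' (t - s.toNNReal) (R (S s.toNNReal x) - R' (S s.toNNReal x)) =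
      R' (S t (R x) - S' t (R x)) := by
  have hsub : Continuous fun s : ℝ => t - s.toNNReal := continuous_const.sub continuous_real_toNNReal
  have hcont : ∀ g : ℝ → X, Continuous g → Continuous fun s : ℝ => S' (t - s.toNNReal) (g s) :=
    fun g hg => continuous_iff_continuousAt.2 fun s =>
      hS'.tendsto_apply hb' (hsub.tendsto s) (hg.tendsto s)
  have hc := hS.continuous_real x
  have hcR := hS.continuous_real (R x)
  rw [intervalIntegral.integral_eq_sub_of_hasDeriv_right_of_le
    (f := fun s : ℝ => S' (t - s.toNNReal) (R' (S s.toNNReal (R x))))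
    (f' := fun s : ℝ => S' (t - s.toNNReal) (R (S s.toNNReal x) - R' (S s.toNNReal x))) t.coe_nonneg
    (hcont _ (R'.continuous.comp hcR)).continuousOn ?_
    ((hcont _ ((R.continuous.comp hc).sub (R'.continuous.comp hc))).intervalIntegrable _ _)]
  · simp [hS.map_zero_apply, hS'.map_zero_apply, apply_comm_of_hasGen hS' hR']
  intro s hs
  refine hasDerivWithinAt_Ioi_of_tendsto ?_
  set r := s.toNNReal with hr
  have hrt : r < t := by rw [hr, Real.toNNReal_lt_iff_lt_coe hs.1.le]; exact hs.2
  set w := S r x with hw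
  have h1 : HasGen S (R w) (-w) := (hR _ _).2 rfl
  have h2 : HasGen S' (R' (R w)) (-(R w)) := (hR' _ _).2 rfl
  have h3 := ((R'.continuous.tendsto _).comp h1).sub h2
  have hlim : Tendsto (fun h : ℝ≥0 => t - (r + h)) (𝓝[>] 0) (𝓝 (t - r)) := by
    have : Continuous fun h : ℝ≥0 => t - (r + h) := by fun_prop
    simpa using (this.tendsto 0).mono_left nhdsWithin_le_nhds
  have h4 := hS'.tendsto_apply hb' hlim h3
  rw [map_neg, sub_neg_eq_add, neg_add_eq_sub] at h4
  refine h4.congr' ?_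
  have hev : ∀ᶠ h : ℝ≥0 in 𝓝[>] 0, h < t - r :=
    nhdsWithin_le_nhds (gt_mem_nhds (tsub_pos_of_lt hrt))
  filter_upwards [hev] with h hh
  -- Splitting off `S' h` leaves the common factor `S' (t - (r + h))` in front of both terms of the
  -- difference quotient.
  have e1 : ∀ v, S' (t - r) v = S' (t - (r + h)) (S' h v) := fun v => by
    rw [← hS'.map_add_apply, ← tsub_tsub, tsub_add_cancel_of_le hh.le]
  rw [toNNReal_add_coe hs.1.le, ← hr, e1, add_comm r h, hS.map_add_apply, ← apply_comm_of_hasGen hS hR r x, ← hw,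
    ← map_sub, ← map_smul]
  congr 1
  simp only [Function.comp, map_smul, map_sub, ← smul_sub]
  congr 1
  abel

/-- The **Trotter–Kato theorem** for exponentially stable semigroups: strong convergence of
the inverses of the generators implies strong convergence of the semigroups. -/
theorem tendsto_semigroup_of_tendsto_inverse {Sn : ℕ → ℝ≥0 → X →L[ℝ] X} (hM : 1 ≤ M) (hε : 0 < ε)
    (hS : IsC0Semigroup S) (hSn : ∀ n, IsC0Semigroup (Sn n))
    (hb : ∀ t, ‖S t‖ ≤ M * Real.exp (-ε * t)) (hbn : ∀ n t, ‖Sn n t‖ ≤ M * Real.exp (-ε * t))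
    (hlim : ∀ y, ∃ (x : X) (xn : ℕ → X), HasGen S x (-y) ∧ (∀ n, HasGen (Sn n) (xn n) (-y)) ∧
      Tendsto xn atTop (𝓝 x)) (t : ℝ≥0) (x : X) :
    Tendsto (fun n => Sn n t x) atTop (𝓝 (S t x)) := by
  obtain ⟨K, hK0, hK⟩ := exists_norm_le_of_hasGen X hM hε
  obtain ⟨R, hR⟩ := hS.exists_inverse hε hb (hK S hS hb)
  choose Rn hRn using fun n => (hSn n).exists_inverse hε (hbn n) (hK _ (hSn n) (hbn n))
  have hB := norm_le_of_exp hM hε hb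
  have hBn := fun n => norm_le_of_exp hM hε (hbn n)
  have hRK : ∀ y, ‖R y‖ ≤ K * ‖y‖ := fun y => by
    simpa using hK S hS hb _ _ ((hR _ y).2 rfl)
  have hRnK : ∀ n y, ‖Rn n y‖ ≤ K * ‖y‖ := fun n y => by
    simpa using hK _ (hSn n) (hbn n) _ _ ((hRn n _ y).2 rfl)
  have hconv : ∀ y, Tendsto (fun n => Rn n y) atTop (𝓝 (R y)) := fun y => by
    obtain ⟨a, an, ha, han, hl⟩ := hlim y
    rw [(hR _ _).1 ha]
    exact hl.congr fun n => ((hRn n _ _).1 (han n)).symm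
  have happ : ∀ (f : ℕ → X), Tendsto f atTop (𝓝 0) →
      Tendsto (fun n => Sn n t (f n)) atTop (𝓝 0) := fun f hf => by
    refine squeeze_zero_norm (fun n => (Sn n t).le_of_opNorm_le (hBn n t) _) ?_
    simpa using hf.norm.const_mul M
  have hdiff : ∀ y, Tendsto (fun n => R y - Rn n y) atTop (𝓝 0) := fun y => by
    simpa using (hconv y).const_sub (R y)
  -- the middle term of the decomposition below
  have hmid : ∀ y, Tendsto (fun n => Rn n (S t (R y) - Sn n t (R y))) atTop (𝓝 0) := fun y => by
    have hlim0 : Tendsto (fun n => ∫ s in (0 : ℝ)..t,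
        Sn n (t - s.toNNReal) (R (S s.toNNReal y) - Rn n (S s.toNNReal y))) atTop
        (𝓝 (∫ s in (0 : ℝ)..t, (0 : X))) := by
      refine intervalIntegral.tendsto_integral_filter_of_dominated_convergence
        (fun _ => M * (2 * K * (M * ‖y‖))) (Eventually.of_forall fun n => ?_)
        (Eventually.of_forall fun n => Eventually.of_forall fun s _ => ?_)
        intervalIntegrable_const (Eventually.of_forall fun s _ => ?_)
      · refine Continuous.aestronglyMeasurable (continuous_iff_continuousAt.2 fun s => ?_)
        have hc := hS.continuous_real y
        exact (hSn n).tendsto_apply (hBn n)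
          ((continuous_const.sub continuous_real_toNNReal).tendsto s)
          (((R.continuous.comp hc).sub ((Rn n).continuous.comp hc)).tendsto s)
      · refine (Sn n _).le_of_opNorm_le_of_le (hBn n _) ?_
        have h1 := (S s.toNNReal).le_of_opNorm_le (hB _) y
        have h2 := norm_sub_le (R (S s.toNNReal y)) (Rn n (S s.toNNReal y))
        have h3 := hRK (S s.toNNReal y)
        have h4 := hRnK n (S s.toNNReal y)
        have h5 := mul_le_mul_of_nonneg_left h1 hK0
        linarith
      · refine squeeze_zero_norm (fun n => (Sn n _).le_of_opNorm_le (hBn n _) _) ?_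
        simpa using (hdiff (S s.toNNReal y)).norm.const_mul M
    rw [intervalIntegral.integral_zero] at hlim0
    exact hlim0.congr fun n => integral_apply_sub_apply hS (hSn n) (hBn n) hR (hRn n) t y
  have hRR : ∀ y, Tendsto (fun n => Sn n t (R (R y))) atTop (𝓝 (S t (R (R y)))) := fun y => by
    have h1 := happ _ (hdiff (R y))
    have h2 := hdiff (S t (R y))
    -- `(Sn t - S t) R R y = Sn t (R - Rn) R y - Rn (S t - Sn t) R y - (R - Rn) S t R y`, since `R`
    -- commutes with `S t` and `Rn` with `Sn t`.
    have h3 := ((h1.sub (hmid y)).sub h2).add_const (S t (R (R y)))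
    simp only [sub_zero, zero_add] at h3
    refine h3.congr fun n => ?_
    rw [map_sub, map_sub, apply_comm_of_hasGen hS hR, apply_comm_of_hasGen (hSn n) (hRn n)]
    abel
  have hdense : DenseRange R := by
    refine hS.dense_domain.mono ?_
    rintro a ⟨b, hab⟩
    exact ⟨-b, (hR _ _).1 (by rwa [neg_neg])⟩
  have hclosed : IsClosed {a : X | Tendsto (fun n => Sn n t a) atTop (𝓝 (S t a))} := by
    -- The operators `Sn n t` are all Lipschitz with constant `M`, hence equicontinuous.
    refine Equicontinuous.isClosed_setOfPred_tendsto ?_ (S t).continuous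
    refine (LipschitzWith.uniformEquicontinuous (fun n => ⇑(Sn n t)) M.toNNReal
      fun n => ?_).equicontinuous
    refine ((Sn n t).lipschitz).weaken ?_
    rw [← norm_toNNReal]
    exact Real.toNNReal_le_toNNReal (hBn n t)
  have hd2 : DenseRange (R ∘ R) := hdense.comp hdense R.continuous
  exact hd2.induction_on (p := fun a => Tendsto (fun n => Sn n t a) atTop (𝓝 (S t a))) x hclosed hRR

end Real

end ShapePreserving

namespace ShapePreserving

/-! ### Rescaling to exponential stability -/

section Rescale

theorem norm_exp_eq {𝕜 : Type*} [RCLike 𝕜] (z : 𝕜) :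
    ‖NormedSpace.exp z‖ = Real.exp (RCLike.re z) := by
  refine (sq_eq_sq₀ (norm_nonneg _) (Real.exp_pos _).le).1 ?_
  -- The squared norm is `exp z * exp (conj z) = exp (z + conj z)`.
  have h1 : ((‖NormedSpace.exp z‖ ^ 2 : ℝ) : 𝕜) = ((Real.exp (2 * RCLike.re z) : ℝ) : 𝕜) := by
    rw [RCLike.ofReal_pow, ← RCLike.mul_conj, starRingEnd_apply, NormedSpace.star_exp,
      ← NormedSpace.exp_add, ← starRingEnd_apply, RCLike.add_conj, Real.exp_eq_exp_ℝ,
      ← RCLike.algebraMap_eq_ofReal, NormedSpace.algebraMap_exp_comm,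
      map_mul, map_ofNat]
  rw [RCLike.ofReal_inj.1 h1, two_mul, Real.exp_add, sq]

variable {𝕜 X : Type*} [RCLike 𝕜] [NormedAddCommGroup X] [NormedSpace 𝕜 X]
  [NormedSpace ℝ X] [IsScalarTower ℝ 𝕜 X]

/-- The rescaled semigroup `e^{-zt} T t`, as a semigroup of real linear operators. -/
noncomputable def rescale (z : 𝕜) (T : ℝ≥0 → X →L[𝕜] X) (t : ℝ≥0) : X →L[ℝ] X :=
  (NormedSpace.exp ((t : ℝ) • -z) • T t).restrictScalars ℝ

theorem rescale_apply (z : 𝕜) (T : ℝ≥0 → X →L[𝕜] X) (t : ℝ≥0) (x : X) :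
    rescale z T t x = NormedSpace.exp ((t : ℝ) • -z) • T t x := rfl

variable {T : ℝ≥0 → X →L[𝕜] X} {A : X →ₗ.[𝕜] X} {M ω : ℝ} {z : 𝕜}

theorem IsC0Semigroup.rescale (hT : IsC0Semigroup T) (z : 𝕜) :
    IsC0Semigroup (rescale z T) where
  map_zero := by
    ext x
    simp [rescale_apply, hT.map_zero]
  map_add s t := by
    ext x
    simp [rescale_apply, hT.map_add, add_smul, NormedSpace.exp_add, mul_smul]
    rw [smul_comm]
  continuous_orbit x := by
    have h1 : Continuous fun t : ℝ≥0 => NormedSpace.exp ((t : ℝ) • -z) :=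
      NormedSpace.exp_continuous.comp (by fun_prop)
    exact h1.smul (hT.continuous_orbit x)

theorem norm_rescale_le (hb : ∀ t : ℝ≥0, ‖T t‖ ≤ M * Real.exp (ω * t)) (t : ℝ≥0) :
    ‖rescale z T t‖ ≤ M * Real.exp (-(RCLike.re z - ω) * t) := by
  rw [rescale, ContinuousLinearMap.norm_restrictScalars, norm_smul, norm_exp_eq]
  refine (mul_le_mul_of_nonneg_left (hb t) (Real.exp_pos _).le).trans_eq ?_
  rw [mul_left_comm, ← Real.exp_add, RCLike.smul_re, map_neg]
  congr 2
  ring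

theorem tendsto_exp_sub_one (z : 𝕜) :
    Tendsto (fun h : ℝ≥0 => (h : ℝ)⁻¹ • (NormedSpace.exp ((h : ℝ) • z) - 1)) (𝓝[>] 0) (𝓝 z) := by
  simpa using tendsto_of_hasDerivAt (hasDerivAt_exp_smul_const (𝕂 := ℝ) z 0)

theorem hasGen_rescale_iff (hT : IsC0Semigroup T) (hA : IsGenerator A T) {x y : X} :
    HasGen (rescale z T) x (y - z • x) ↔ (x, y) ∈ A.graph := by
  have hexp : Continuous fun h : ℝ≥0 => NormedSpace.exp ((h : ℝ) • -z) :=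
    NormedSpace.exp_continuous.comp (by fun_prop)
  have hlim : ∀ x, Tendsto (fun h : ℝ≥0 => T h x) (𝓝[>] 0) (𝓝 x) := fun x => by
    have := ((hT.continuous_orbit x).tendsto 0).mono_left
      (nhdsWithin_le_nhds (s := Set.Ioi 0))
    rwa [hT.map_zero] at this
  -- the difference of the two difference quotients
  have hdiff : Tendsto (fun h : ℝ≥0 =>
      (h : ℝ)⁻¹ • (NormedSpace.exp ((h : ℝ) • -z) - 1) • T h x) (𝓝[>] 0) (𝓝 (-(z • x))) := by
    rw [← neg_smul]
    exact ((tendsto_exp_sub_one (-z)).smul (hlim x)).congr fun h => smul_assoc _ _ _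
  have hscal : ∀ (h : ℝ≥0) (v : X), ((h : ℝ) : 𝕜)⁻¹ • v = (h : ℝ)⁻¹ • v := fun h v => by
    rw [← RCLike.ofReal_inv, RCLike.real_smul_eq_coe_smul (K := 𝕜)]
  rw [hA, HasGen]
  simp only [hscal]
  constructor
  · intro h
    have h1 := h.sub hdiff
    rw [sub_neg_eq_add, sub_add_cancel] at h1
    refine h1.congr fun r => ?_
    rw [← smul_sub, rescale_apply, sub_smul, one_smul]
    congr 1
    abel
  · intro h
    have h1 := h.add hdiff
    rw [← sub_eq_add_neg] at h1
    refine h1.congr fun r => ?_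
    rw [← smul_add, rescale_apply, sub_smul, one_smul]
    congr 1
    abel

variable [CompleteSpace X]

/-- `Function.invFun` is meaningful only at values that are attained; surjectivity of the rescaled
generator `A - z` shows that `y` is one. -/
theorem hasGen_resolvent (hT : IsC0Semigroup T) (hA : IsGenerator A T) (hz : ω < RCLike.re z)
    (hb : ∀ t : ℝ≥0, ‖T t‖ ≤ M * Real.exp (ω * t)) (y : X) :
    HasGen (rescale z T) (resolvent A z y) (-y) := by
  obtain ⟨x, hx⟩ := (hT.rescale z).exists_hasGen (sub_pos.2 hz) (norm_rescale_le hb) (-y)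
  have h1 : (x, z • x - y) ∈ A.graph :=
    (hasGen_rescale_iff (z := z) hT hA).1 (by rwa [sub_sub_cancel_left])
  obtain ⟨a, ha, ha'⟩ := (LinearPMap.mem_graph_iff A).1 h1
  have h2 : ∃ a : A.domain, z • (a : X) - A a = y := ⟨a, by
    simp only at ha ha'
    rw [ha', ha, sub_sub_cancel]⟩
  have h3 := Function.invFun_eq (f := fun x : A.domain => z • (x : X) - A x) h2
  have h4 := (hasGen_rescale_iff (z := z) hT hA).2 (A.mem_graph
    (Function.invFun (fun x : A.domain => z • (x : X) - A x) y))
  rwa [← neg_sub, h3] at h4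

end Rescale

/-- The **Trotter–Kato theorem**: strong convergence of the resolvents at one point implies strong
convergence of the semigroups. -/
theorem tendsto_semigroup_of_tendsto_resolvent {𝕜 X : Type*} [RCLike 𝕜] [NormedAddCommGroup X]
    [NormedSpace 𝕜 X] [CompleteSpace X] {A : X →ₗ.[𝕜] X} {T : ℝ≥0 → X →L[𝕜] X}
    (hT : IsC0Semigroup T) (hA : IsGenerator A T)
    {An : ℕ → X →ₗ.[𝕜] X} {Tn : ℕ → ℝ≥0 → X →L[𝕜] X}
    (hTn : ∀ n, IsC0Semigroup (Tn n)) (hAn : ∀ n, IsGenerator (An n) (Tn n))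
    {M ω : ℝ} (hM : 1 ≤ M) (hbound : ∀ t : ℝ≥0, ‖T t‖ ≤ M * Real.exp (ω * t))
    (hboundn : ∀ (n : ℕ) (t : ℝ≥0), ‖Tn n t‖ ≤ M * Real.exp (ω * t))
    {z : 𝕜} (hz : ω < RCLike.re z)
    (hres : ∀ x : X, Tendsto (fun n => resolvent (An n) z x) atTop (𝓝 (resolvent A z x)))
    (t : ℝ≥0) (x : X) : Tendsto (fun n => Tn n t x) atTop (𝓝 (T t x)) := by
  let _ : NormedSpace ℝ X := NormedSpace.restrictScalars ℝ 𝕜 X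
  have _ : IsScalarTower ℝ 𝕜 X := RestrictScalars.isScalarTower ℝ 𝕜 X
  have h1 := tendsto_semigroup_of_tendsto_inverse hM (sub_pos.2 hz) (hT.rescale z)
    (fun n => (hTn n).rescale z) (norm_rescale_le hbound) (fun n => norm_rescale_le (hboundn n))
    (fun y => ⟨_, _, hasGen_resolvent hT hA hz hbound y,
      fun n => hasGen_resolvent (hTn n) (hAn n) hz (hboundn n) y, hres y⟩) t x
  have h2 := h1.const_smul (NormedSpace.exp ((t : ℝ) • -z))⁻¹
  have hne : NormedSpace.exp ((t : ℝ) • -z) ≠ 0 :=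
    norm_ne_zero_iff.1 (by rw [norm_exp_eq]; exact (Real.exp_pos _).ne')
  simpa only [rescale_apply, inv_smul_smul₀ hne] using h2

end ShapePreserving

/-! ### Shape preservation in the limit -/

theorem mainTheorem3 {𝕜 X Y : Type*} [RCLike 𝕜]
    [NormedAddCommGroup X] [NormedSpace 𝕜 X] [CompleteSpace X]
    [NormedAddCommGroup Y] [NormedSpace 𝕜 Y] [CompleteSpace Y]
    [NormedSpace ℝ Y] [IsScalarTower ℝ 𝕜 Y]
    [PartialOrder Y] [IsOrderedAddMonoid Y] [IsOrderedModule ℝ Y]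
    (hY : IsClosed {y : Y | 0 ≤ y})
    (S : X →ₗ.[𝕜] Y) (hS : S.IsClosed)
    (A : X →ₗ.[𝕜] X) (T : ℝ≥0 → X →L[𝕜] X)
    (hT : ShapePreserving.IsC0Semigroup T) (hA : ShapePreserving.IsGenerator A T)
    (An : ℕ → X →ₗ.[𝕜] X) (Tn : ℕ → ℝ≥0 → X →L[𝕜] X)
    (hTn : ∀ n, ShapePreserving.IsC0Semigroup (Tn n))
    (hAn : ∀ n, ShapePreserving.IsGenerator (An n) (Tn n))
    (hshape : ∀ n, ShapePreserving.PreservesShape S (An n) (Tn n))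
    (M ω : ℝ) (hM : 1 ≤ M)
    (hbound : ∀ t : ℝ≥0, ‖T t‖ ≤ M * Real.exp (ω * t))
    (hboundn : ∀ (n : ℕ) (t : ℝ≥0), ‖Tn n t‖ ≤ M * Real.exp (ω * t))
    (hres : ∃ z : 𝕜, ω < RCLike.re z ∧
      ∀ x : X, Tendsto (fun n => ShapePreserving.resolvent (An n) z x) atTop
        (𝓝 (ShapePreserving.resolvent A z x)))
    (hcomp : ShapePreserving.shapeConeOf S A = ShapePreserving.shapeCone S) :
    ShapePreserving.PreservesShape S A T := by
  obtain ⟨z, hz, hres⟩ := hres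
  refine ⟨hcomp.symm, fun t x hx => ?_⟩
  exact isClosed_closure.mem_of_tendsto
    (ShapePreserving.tendsto_semigroup_of_tendsto_resolvent hT hA hTn hAn hM hbound hboundn hz hres
      t x)
    (Eventually.of_forall fun n => (hshape n).2 t hx)
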